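/- Let $X$ and $Y$ be infinite dimensional complex Banach spaces, let $S\in L(X)$ and $T\in L(Y)$ be bounded linear operators, and let $S\oplus T$ be the operator $(x,y)\mapsto(Sx,Ty)$ on $X\oplus Y$. For a bounded linear operator $A$ on a complex Banach space write $N(A)$ and $R(A)$ for its kernel and range, $\alpha(A)=\dim N(A)$ and $\beta(A)=\operatorname{codim}R(A)$ (in $\mathbb N\cup\{\infty\}$), $\sigma(A)$ for its spectrum, and $\sigma_a(A)=\{\lambda\in\mathbb C: A-\lambda I \text{ is not bounded below}\}$ for its approximate spectrum. The operator $A$ is upper semi-Weyl if $R(A)$ is closed, $\alpha(A)<\infty$ and $\operatorname{ind}A=\alpha(A)-\beta(A)\le 0$; put $\sigma_{uw}(A)=\{\lambda\in\mathbb C: A-\lambda I\text{ is not upper semi-Weyl}\}$. The ascent $a(A)$ is the least integer $n\ge 0$ with $N(A^n)=N(A^{n+1})$, and $\infty$ if there is none. Let $p_{00}^a(A)$ be the set of left poles of $A$ of finite rank, that is, of all $\lambda\in\sigma_a(A)$ such that $p=a(A-\lambda I)<\infty$, $R((A-\lambda I)^{p+1})$ is closed and $\alpha(A-\lambda I)<\infty$.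 The operator $A$ satisfies property $(az)$ if $\sigma(A)\setminus\sigma_{uw}(A)=p_{00}^a(A)$. Suppose that $S$ and $T$ both satisfy property $(az)$. Then $S\oplus T$ satisfies property $(az)$ if and only if $\sigma_{uw}(S\oplus T)=\sigma_{uw}(S)\cup\sigma_{uw}(T)$. -/

import Mathlib

/-! Spectral and Fredholm-theoretic notions for a bounded linear operator `T : X →L[ℂ] X`
on a complex Banach space. -/

namespace BanachOp

noncomputable section

variable {X : Type*} [NormedAddCommGroup X] [NormedSpace ℂ X]

/-- The operator `T - λ I`. -/
def shift (T : X →L[ℂ] X) (l : ℂ) : X →L[ℂ] X := T - l • (1 : X →L[ℂ] X)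

/-- `α(T)`: the dimension of the kernel of `T` (`⊤` if infinite). -/
def nullity (T : X →L[ℂ] X) : ℕ∞ :=
  Cardinal.toENat (Module.rank ℂ (LinearMap.ker (T : X →ₗ[ℂ] X)))

/-- `β(T)`: the codimension of the range of `T` (`⊤` if infinite). -/
def defect (T : X →L[ℂ] X) : ℕ∞ :=
  Cardinal.toENat (Module.rank ℂ (X ⧸ LinearMap.range (T : X →ₗ[ℂ] X)))

/-- `T` is upper semi-Fredholm: its range is closed and its kernel is finite dimensional. -/
def IsUpperSemiFredholm (T : X →L[ℂ] X) : Prop :=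
  IsClosed (Set.range T) ∧ nullity T < ⊤

/-- The index `α(T) - β(T)`, an extended integer. It is meant for semi-Fredholm operators,
for which at least one of the two terms is finite. -/
def index (T : X →L[ℂ] X) : EReal := ((nullity T : ℕ∞) : EReal) - ((defect T : ℕ∞) : EReal)

/-- `T` is upper semi-Weyl: upper semi-Fredholm of index at most `0`. -/
def IsUpperSemiWeyl (T : X →L[ℂ] X) : Prop :=
  IsUpperSemiFredholm T ∧ index T ≤ 0

/-- The ascent of `T`: the infimum of all `n` with `ker (T ^ n) = ker (T ^ (n + 1))`,
which is `⊤` if there is no such `n`. -/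
def ascent (T : X →L[ℂ] X) : ℕ∞ :=
  ⨅ (n : ℕ) (_ : LinearMap.ker ((T ^ n : X →L[ℂ] X) : X →ₗ[ℂ] X) =
    LinearMap.ker ((T ^ (n + 1) : X →L[ℂ] X) : X →ₗ[ℂ] X)), (n : ℕ∞)

/-- `T` is bounded below. -/
def IsBoundedBelow (T : X →L[ℂ] X) : Prop :=
  ∃ c : ℝ, 0 < c ∧ ∀ x : X, c * ‖x‖ ≤ ‖T x‖

/-- The approximate (point) spectrum `σ_a(T)`. -/
def approxSpectrum (T : X →L[ℂ] X) : Set ℂ :=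
  {l | ¬ IsBoundedBelow (shift T l)}

/-- The upper semi-Weyl spectrum `σ_uw(T)`. -/
def upperSemiWeylSpectrum (T : X →L[ℂ] X) : Set ℂ :=
  {l | ¬ IsUpperSemiWeyl (shift T l)}

/-- The left poles of `T`: the points `l` of the approximate spectrum such that
`p = ascent (T - l I)` is finite and `(T - l I) ^ (p + 1)` has closed range. -/
def leftPoles (T : X →L[ℂ] X) : Set ℂ :=
  {l | l ∈ approxSpectrum T ∧
    ∃ p : ℕ, ascent (shift T l) = p ∧ IsClosed (Set.range (shift T l ^ (p + 1)))}

/-- The left poles of finite rank `p_00^a(T)`: the left poles `l` such that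
the kernel of `T - l I` is finite dimensional. -/
def finiteRankLeftPoles (T : X →L[ℂ] X) : Set ℂ :=
  {l | l ∈ leftPoles T ∧ nullity (shift T l) < ⊤}

/-- Property `(az)`. -/
def PropertyAZ (T : X →L[ℂ] X) : Prop :=
  spectrum ℂ T \ upperSemiWeylSpectrum T = finiteRankLeftPoles T

end

end BanachOp

namespace BanachOp

variable {X Y : Type*} [NormedAddCommGroup X] [NormedSpace ℂ X]
  [NormedAddCommGroup Y] [NormedSpace ℂ Y]

/-! The left poles of finite rank are the points of the approximate spectrum where the shift is
upper semi-Browder (`mem_finiteRankLeftPoles_iff`), and semi-Browder implies semi-Weyl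
(`HasFiniteAscent.nullity_le_defect`). So (az) says: wherever the shift is semi-Weyl it is
semi-Browder, and it is bounded below only if bijective. Semi-Browder passes to a direct sum and
back to its summands. Semi-Weyl need not pass back, since only the total index is constrained;
equality of spectra rules this failure out. Given (az) for `S` and `T`, semi-Weyl summands always
have a semi-Weyl sum, so only the splitting is at stake. -/

theorem nullity_lt_top_iff {A : X →L[ℂ] X} :
    nullity A < ⊤ ↔ FiniteDimensional ℂ (LinearMap.ker (A : X →ₗ[ℂ] X)) := by
  rw [nullity, Cardinal.toENat_lt_top, Module.rank_lt_aleph0_iff]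

theorem index_nonpos_iff {A : X →L[ℂ] X} :
    index A ≤ 0 ↔ nullity A ≤ defect A := by
  rw [index, EReal.sub_nonpos]
  exact EReal.coe_ennreal_le_coe_ennreal_iff.trans ENat.toENNReal_le

/-- The kernels of the powers of `A` are eventually constant. -/
def HasFiniteAscent (A : X →L[ℂ] X) : Prop :=
  ∃ n : ℕ, ∀ x, (A ^ (n + 1)) x = 0 → (A ^ n) x = 0

/-- `A` is upper semi-Browder: upper semi-Fredholm of finite ascent. -/
def IsUpperSemiBrowder (A : X →L[ℂ] X) : Prop :=
  IsUpperSemiFredholm A ∧ HasFiniteAscent A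

/-! ### Ascent, kernels of powers and the index -/

theorem ker_pow_eq_iff {A : X →L[ℂ] X} {n : ℕ} :
    LinearMap.ker ((A ^ n : X →L[ℂ] X) : X →ₗ[ℂ] X) =
      LinearMap.ker ((A ^ (n + 1) : X →L[ℂ] X) : X →ₗ[ℂ] X) ↔
    ∀ x, (A ^ (n + 1)) x = 0 → (A ^ n) x = 0 := by
  constructor
  · intro h x hx
    have : x ∈ LinearMap.ker ((A ^ n : X →L[ℂ] X) : X →ₗ[ℂ] X) := by
      rw [h]
      exact hx
    exact this
  · intro h
    ext x
    refine ⟨fun hx => ?_, h x⟩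
    have hx' : (A ^ n) x = 0 := hx
    change (A ^ (n + 1)) x = 0
    rw [pow_succ', mul_apply_eq_comp, hx', map_zero]

theorem hasFiniteAscent_iff_exists_ascent_eq {A : X →L[ℂ] X} :
    HasFiniteAscent A ↔ ∃ p : ℕ, ascent A = p := by
  rw [← ENat.ne_top_iff_exists.trans (exists_congr fun _ => eq_comm), ← lt_top_iff_ne_top,
    ascent, iInf_lt_iff]
  refine exists_congr fun n => ?_
  rw [iInf_lt_iff, ker_pow_eq_iff]
  exact ⟨fun h => ⟨h, ENat.natCast_lt_top n⟩, fun ⟨h, _⟩ => h⟩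

theorem kernel_stable_of_le {A : X →L[ℂ] X} {n m : ℕ} (hnm : n ≤ m)
    (h : ∀ x, (A ^ (n + 1)) x = 0 → (A ^ n) x = 0) (x : X) (hx : (A ^ (m + 1)) x = 0) :
    (A ^ m) x = 0 := by
  obtain ⟨k, rfl⟩ := Nat.exists_eq_add_of_le hnm
  rw [pow_add, mul_apply_eq_comp]
  apply h
  rwa [← mul_apply_eq_comp, ← pow_add, add_right_comm]

/-- `A ^ n` maps `ker (A ^ (n + 1))` into `ker A`, and the kernel of this map lies in `ker (A ^ n)`.
-/
theorem finiteDimensional_ker_pow {A : X →L[ℂ] X}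
    (h : FiniteDimensional ℂ (LinearMap.ker (A : X →ₗ[ℂ] X))) (n : ℕ) :
    FiniteDimensional ℂ (LinearMap.ker ((A ^ n : X →L[ℂ] X) : X →ₗ[ℂ] X)) := by
  induction n with
  | zero =>
    have : LinearMap.ker ((A ^ 0 : X →L[ℂ] X) : X →ₗ[ℂ] X) = ⊥ := by
      ext x
      simp
    rw [this]
    infer_instance
  | succ n ih =>
    let f : LinearMap.ker ((A ^ (n + 1) : X →L[ℂ] X) : X →ₗ[ℂ] X) →ₗ[ℂ]
        LinearMap.ker (A : X →ₗ[ℂ] X) :=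
      (((A ^ n : X →L[ℂ] X) : X →ₗ[ℂ] X).comp (Submodule.subtype _)).codRestrict _ fun x => by
        have hx : (A ^ (n + 1)) x.1 = 0 := x.2
        change A ((A ^ n) x.1) = 0
        rwa [← mul_apply_eq_comp, ← pow_succ']
    let g : LinearMap.ker f →ₗ[ℂ] LinearMap.ker ((A ^ n : X →L[ℂ] X) : X →ₗ[ℂ] X) :=
      ((Submodule.subtype _).comp (Submodule.subtype _)).codRestrict _ fun x =>
        congrArg Subtype.val x.2
    have hg : Function.Injective g := fun x y hxy =>
      Subtype.ext (Subtype.ext (congrArg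
        (fun z : LinearMap.ker ((A ^ n : X →L[ℂ] X) : X →ₗ[ℂ] X) => (z : X)) hxy))
    have : FiniteDimensional ℂ (LinearMap.ker f) := Module.Finite.of_injective g hg
    have := Module.Finite.equiv f.quotKerEquivRange.symm
    exact Module.Finite.of_submodule_quotient (LinearMap.ker f)

/-- With `K = ker (A ^ n)` for `n` at least the ascent, `K / A K` has the dimension of `ker A`
and embeds in `X / range A`. -/
theorem HasFiniteAscent.nullity_le_defect {A : X →L[ℂ] X} (hA : HasFiniteAscent A)
    (hfin : nullity A < ⊤) : nullity A ≤ defect A := by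
  obtain ⟨n₀, h₀⟩ := hA
  -- `1 ≤ n` ensures `ker A ≤ K`, even when the ascent is `0`.
  obtain ⟨n, hn, hn1⟩ : ∃ n, n₀ ≤ n ∧ 1 ≤ n := ⟨n₀ + 1, by omega, by omega⟩
  have h := kernel_stable_of_le hn h₀
  rw [nullity_lt_top_iff] at hfin
  have hK := finiteDimensional_ker_pow hfin n
  set K := LinearMap.ker ((A ^ n : X →L[ℂ] X) : X →ₗ[ℂ] X)
  have hAK : ∀ x ∈ K, A x ∈ K := fun x hx => by
    have hx' : (A ^ n) x = 0 := hx
    change (A ^ n) (A x) = 0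
    rw [← mul_apply_eq_comp, ← pow_succ, pow_succ', mul_apply_eq_comp,
      hx', map_zero]
  let f : K →ₗ[ℂ] K := (A : X →ₗ[ℂ] X).restrict hAK
  have hker : LinearMap.ker (A : X →ₗ[ℂ] X) ≤ K := fun x hx => by
    have hx' : A x = 0 := hx
    change (A ^ n) x = 0
    obtain ⟨k, rfl⟩ := Nat.exists_eq_add_of_le' hn1
    rw [pow_succ, mul_apply_eq_comp, hx', map_zero]
  let i : LinearMap.ker (A : X →ₗ[ℂ] X) →ₗ[ℂ] LinearMap.ker f :=
    (Submodule.inclusion hker).codRestrict _ fun x => Subtype.ext x.2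
  have hi : Function.Injective i := fun x y hxy =>
    Subtype.ext (congrArg (fun z : LinearMap.ker f => (z : X)) hxy)
  let q : K ⧸ LinearMap.range f →ₗ[ℂ] X ⧸ LinearMap.range (A : X →ₗ[ℂ] X) :=
    Submodule.mapQ _ _ K.subtype (by
      rintro _ ⟨x, rfl⟩
      exact ⟨x, rfl⟩)
  -- If `A x ∈ K` then `A ^ (n + 1)` kills `x`, so `x ∈ K` by stability.
  have hq : Function.Injective q := by
    rw [← LinearMap.ker_eq_bot, Submodule.ker_mapQ, ← le_bot_iff, Submodule.map_le_iff_le_comap,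
      ← LinearMap.ker, Submodule.ker_mkQ]
    rintro y ⟨x, hx⟩
    have hx' : A x = y := hx
    refine ⟨⟨x, h x ?_⟩, Subtype.ext hx'⟩
    rw [pow_succ, mul_apply_eq_comp, hx']
    exact y.2
  have hdim : Module.rank ℂ (LinearMap.ker f) = Module.rank ℂ (K ⧸ LinearMap.range f) := by
    rw [← Module.finrank_eq_rank, ← Module.finrank_eq_rank]
    have h1 := f.finrank_range_add_finrank_ker
    have h2 := (LinearMap.range f).finrank_quotient_add_finrank
    congr 1
    omega
  refine Cardinal.toENat.monotone' ?_
  exact (LinearMap.rank_le_of_injective i hi).trans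
    (hdim.le.trans (LinearMap.rank_le_of_injective q hq))

theorem IsUpperSemiBrowder.isUpperSemiWeyl {A : X →L[ℂ] X} (hA : IsUpperSemiBrowder A) :
    IsUpperSemiWeyl A :=
  ⟨hA.1, index_nonpos_iff.2 (hA.2.nullity_le_defect hA.1.2)⟩

theorem isUpperSemiBrowder_of_bijective {A : X →L[ℂ] X} (hA : Function.Bijective A) :
    IsUpperSemiBrowder A := by
  refine ⟨⟨by rw [hA.2.range_eq]; exact isClosed_univ, ?_⟩, 0, fun x hx => ?_⟩
  · rw [nullity_lt_top_iff, LinearMap.ker_eq_bot.2 hA.1]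
    infer_instance
  · rw [zero_add, pow_one] at hx
    rw [pow_zero, one_apply_eq_self]
    exact hA.1 (hx.trans (map_zero A).symm)

/-! ### Closed ranges of powers -/

theorem antilipschitzWith_of_comp {α β γ : Type*} [PseudoEMetricSpace α] [PseudoEMetricSpace β]
    [PseudoEMetricSpace γ] {g : β → γ} {f : α → β} {K c : NNReal} (hg : LipschitzWith K g)
    (h : AntilipschitzWith c (g ∘ f)) : AntilipschitzWith (c * K) f := fun x y => by
  rw [ENNReal.coe_mul, mul_assoc]
  exact (h x y).trans (mul_le_mul_right (hg (f x) (f y)) _)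

/-- On a closed complement `M` of `ker (A ^ (n + 1))`, the power is injective with the same closed
range, hence bounded below; so `A` is too. Thus `A(M)` is closed, and `range A` exceeds it by a
finite-dimensional space. -/
theorem isClosed_range_of_pow_succ [CompleteSpace X] {A : X →L[ℂ] X} {n : ℕ}
    (hker : FiniteDimensional ℂ (LinearMap.ker (A : X →ₗ[ℂ] X)))
    (hcl : IsClosed (Set.range (A ^ (n + 1)))) : IsClosed (Set.range A) := by
  have hK := finiteDimensional_ker_pow hker (n + 1)
  set K := LinearMap.ker ((A ^ (n + 1) : X →L[ℂ] X) : X →ₗ[ℂ] X)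
  obtain ⟨M, hM, hKM⟩ :=
    (Submodule.ClosedComplemented.of_finiteDimensional K).exists_isClosed_isCompl
  have : CompleteSpace M := hM.completeSpace_coe
  let C : M →L[ℂ] X := (A ^ (n + 1)).comp M.subtypeL
  have hCinj : Function.Injective C := by
    rw [injective_iff_map_eq_zero]
    intro x hx
    exact Subtype.ext (Submodule.disjoint_def.1 hKM.disjoint x hx x.2)
  have hCrange : Set.range C = Set.range (A ^ (n + 1)) := by
    ext y
    constructor
    · rintro ⟨x, rfl⟩
      exact ⟨x, rfl⟩
    · rintro ⟨x, rfl⟩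
      obtain ⟨k, hk, m, hm, rfl⟩ := Submodule.mem_sup.1 (hKM.sup_eq_top ▸ Submodule.mem_top (x := x))
      have hk' : (A ^ (n + 1)) k = 0 := hk
      refine ⟨⟨m, hm⟩, ?_⟩
      rw [map_add, hk', zero_add]
      rfl
  obtain ⟨c, hc⟩ := C.antilipschitz_of_injective_of_isClosed_range hCinj (hCrange ▸ hcl)
  let B : M →L[ℂ] X := A.comp M.subtypeL
  have hCB : (C : M → X) = (A ^ n) ∘ B := by
    ext x
    change (A ^ (n + 1)) (x : X) = (A ^ n) (A x)
    rw [pow_succ, mul_apply_eq_comp]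
  rw [hCB] at hc
  have hB : IsClosed (Set.range B) :=
    (antilipschitzWith_of_comp (A ^ n).lipschitz hc).isClosed_range B.uniformContinuous
  have hrange : LinearMap.range (B : M →ₗ[ℂ] X) ⊔ K.map (A : X →ₗ[ℂ] X) =
      LinearMap.range (A : X →ₗ[ℂ] X) := by
    rw [LinearMap.range_eq_map (A : X →ₗ[ℂ] X), ← hKM.sup_eq_top, Submodule.map_sup, sup_comm]
    congr 1
    ext y
    simp [B]
  have := Submodule.isClosed_sup_finiteDimensional (LinearMap.range (B : M →ₗ[ℂ] X))
    (K.map (A : X →ₗ[ℂ] X)) hB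
  rw [hrange] at this
  exact this

/-- By the open mapping theorem `A` is a quotient map onto its range, and the preimage of `A(N)` is
the closed space `N + ker A`. -/
theorem IsUpperSemiFredholm.isClosed_map [CompleteSpace X] {A : X →L[ℂ] X}
    (hA : IsUpperSemiFredholm A) (N : Submodule ℂ X) (hN : IsClosed (N : Set X)) :
    IsClosed (A '' N) := by
  have hfin := nullity_lt_top_iff.1 hA.2
  have : CompleteSpace (LinearMap.range (A : X →ₗ[ℂ] X)) := (show IsClosed (LinearMap.range (A : X →ₗ[ℂ] X) : Set X) from hA.1).completeSpace_coe
  have hq : Topology.IsQuotientMap A.rangeRestrict :=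
    (A.rangeRestrict.isOpenMap (LinearMap.surjective_rangeRestrict _)).isQuotientMap
      A.rangeRestrict.continuous (LinearMap.surjective_rangeRestrict _)
  have hcl : IsClosed (A.rangeRestrict '' (N : Set X)) := by
    rw [← hq.isClosed_preimage]
    convert Submodule.isClosed_sup_finiteDimensional N (LinearMap.ker (A : X →ₗ[ℂ] X)) hN using 1
    rw [← Submodule.comap_map_eq]
    ext x
    change (∃ y ∈ N, A.rangeRestrict y = A.rangeRestrict x) ↔ ∃ y ∈ N, A y = A x
    exact exists_congr fun y => and_congr_right fun _ => Subtype.ext_iff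
  have := (IsClosed.isClosedEmbedding_subtypeVal hA.1).isClosedMap _ hcl
  have himage : A '' N = Subtype.val '' (A.rangeRestrict '' (N : Set X)) :=
    Set.image_comp Subtype.val A.rangeRestrict (N : Set X)
  rwa [himage]

theorem IsUpperSemiFredholm.isClosed_range_pow [CompleteSpace X] {A : X →L[ℂ] X}
    (hA : IsUpperSemiFredholm A) (n : ℕ) : IsClosed (Set.range (A ^ n)) := by
  induction n with
  | zero => simp [Function.id_def]
  | succ n ih =>
    have := hA.isClosed_map (LinearMap.range ((A ^ n : X →L[ℂ] X) : X →ₗ[ℂ] X)) ih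
    have hcomp : ⇑(A ^ (n + 1)) = A ∘ (A ^ n) := by
      ext x
      rw [pow_succ', mul_apply_eq_comp, Function.comp_apply]
    rw [hcomp, Set.range_comp]
    exact this

/-! ### Property (az) through semi-Browder operators -/

theorem mem_finiteRankLeftPoles_iff [CompleteSpace X] {T : X →L[ℂ] X} {l : ℂ} :
    l ∈ finiteRankLeftPoles T ↔
      ¬ IsBoundedBelow (shift T l) ∧ IsUpperSemiBrowder (shift T l) := by
  constructor
  · rintro ⟨⟨hb, p, hp, hcl⟩, hfin⟩
    exact ⟨hb, ⟨isClosed_range_of_pow_succ (nullity_lt_top_iff.1 hfin) hcl, hfin⟩,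
      hasFiniteAscent_iff_exists_ascent_eq.2 ⟨p, hp⟩⟩
  · rintro ⟨hb, hF, ha⟩
    obtain ⟨p, hp⟩ := hasFiniteAscent_iff_exists_ascent_eq.1 ha
    exact ⟨⟨hb, p, hp, hF.isClosed_range_pow _⟩, hF.2⟩

theorem mem_spectrum_iff_not_bijective [CompleteSpace X] {T : X →L[ℂ] X} {l : ℂ} :
    l ∈ spectrum ℂ T ↔ ¬ Function.Bijective (shift T l) := by
  rw [spectrum.mem_iff, ← ContinuousLinearMap.isUnit_iff_bijective, ← IsUnit.neg_iff, neg_sub,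
    Algebra.algebraMap_eq_smul_one]
  rfl

theorem isBoundedBelow_of_bijective [CompleteSpace X] {A : X →L[ℂ] X}
    (hA : Function.Bijective A) : IsBoundedBelow A := by
  obtain ⟨c, h⟩ := A.antilipschitz_of_injective_of_isClosed_range hA.1
    (by rw [hA.2.range_eq]; exact isClosed_univ)
  -- The antilipschitz constant `c` may be `0`, hence the `+ 1`.
  refine ⟨((c : ℝ) + 1)⁻¹, by positivity, fun x => ?_⟩
  rw [inv_mul_le_iff₀ (by positivity)]
  have := h.le_mul_dist x 0
  simp only [map_zero, dist_zero_right] at this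
  nlinarith [norm_nonneg (A x)]

theorem propertyAZ_iff [CompleteSpace X] {T : X →L[ℂ] X} :
    PropertyAZ T ↔ ∀ l, IsUpperSemiWeyl (shift T l) →
      IsUpperSemiBrowder (shift T l) ∧
        (¬ Function.Bijective (shift T l) → ¬ IsBoundedBelow (shift T l)) := by
  simp only [PropertyAZ, Set.ext_iff, Set.mem_sdiff, mem_spectrum_iff_not_bijective,
    mem_finiteRankLeftPoles_iff, upperSemiWeylSpectrum, Set.mem_ofPred_eq, not_not]
  refine forall_congr' fun l => ⟨fun h hW => ?_, fun h => ⟨fun ⟨hb, hW⟩ => ?_, fun ⟨hb, hB⟩ => ?_⟩⟩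
  · by_cases hb : Function.Bijective (shift T l)
    · exact ⟨isUpperSemiBrowder_of_bijective hb, fun h => absurd hb h⟩
    · obtain ⟨h1, h2⟩ := h.1 ⟨hb, hW⟩
      exact ⟨h2, fun _ => h1⟩
  · exact ⟨(h hW).2 hb, (h hW).1⟩
  · exact ⟨fun h => hb (isBoundedBelow_of_bijective h), hB.isUpperSemiWeyl⟩

/-! ### Direct sums -/

theorem shift_prodMap (S : X →L[ℂ] X) (T : Y →L[ℂ] Y) (l : ℂ) :
    shift (S.prodMap T) l = (shift S l).prodMap (shift T l) := by
  ext x <;> simp [shift]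

theorem prodMap_pow_apply (A : X →L[ℂ] X) (B : Y →L[ℂ] Y) (n : ℕ) (z : X × Y) :
    (A.prodMap B ^ n) z = ((A ^ n) z.1, (B ^ n) z.2) := by
  induction n with
  | zero => simp
  | succ n ih => simp [pow_succ', ih]

theorem hasFiniteAscent_prodMap_iff {A : X →L[ℂ] X} {B : Y →L[ℂ] Y} :
    HasFiniteAscent (A.prodMap B) ↔ HasFiniteAscent A ∧ HasFiniteAscent B := by
  simp only [HasFiniteAscent, prodMap_pow_apply, Prod.mk_eq_zero]
  constructor
  · rintro ⟨n, h⟩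
    exact ⟨⟨n, fun x hx => (h (x, 0) ⟨hx, map_zero _⟩).1⟩,
      ⟨n, fun y hy => (h (0, y) ⟨map_zero _, hy⟩).2⟩⟩
  · rintro ⟨⟨n, hn⟩, m, hm⟩
    exact ⟨max n m, fun z hz => ⟨kernel_stable_of_le (le_max_left n m) hn _ hz.1,
      kernel_stable_of_le (le_max_right n m) hm _ hz.2⟩⟩

theorem isUpperSemiFredholm_prodMap_iff {A : X →L[ℂ] X} {B : Y →L[ℂ] Y} :
    IsUpperSemiFredholm (A.prodMap B) ↔ IsUpperSemiFredholm A ∧ IsUpperSemiFredholm B := by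
  have hker : nullity (A.prodMap B) < ⊤ ↔ nullity A < ⊤ ∧ nullity B < ⊤ := by
    have hk : LinearMap.ker (A.prodMap B : X × Y →ₗ[ℂ] X × Y) =
        (LinearMap.ker (A : X →ₗ[ℂ] X)).prod (LinearMap.ker (B : Y →ₗ[ℂ] Y)) :=
      LinearMap.ker_prodMap _ _
    rw [nullity_lt_top_iff, nullity_lt_top_iff, nullity_lt_top_iff, hk]
    constructor
    · intro h
      refine ⟨Module.Finite.of_injective ((LinearMap.inl ℂ X Y).restrict (q :=
          (LinearMap.ker (A : X →ₗ[ℂ] X)).prod (LinearMap.ker (B : Y →ₗ[ℂ] Y)))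
          fun x hx => ⟨hx, zero_mem _⟩) ?_,
        Module.Finite.of_injective ((LinearMap.inr ℂ X Y).restrict (q :=
          (LinearMap.ker (A : X →ₗ[ℂ] X)).prod (LinearMap.ker (B : Y →ₗ[ℂ] Y)))
          fun x hx => ⟨zero_mem _, hx⟩) ?_⟩
      · intro x y hxy
        exact Subtype.ext (congrArg (fun z => z.1.1) hxy)
      · intro x y hxy
        exact Subtype.ext (congrArg (fun z => z.1.2) hxy)
    · rintro ⟨h1, h2⟩
      exact Module.Finite.iff_fg.2 ((Module.Finite.iff_fg.1 h1).prod (Module.Finite.iff_fg.1 h2))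
  have hrange : IsClosed (Set.range (A.prodMap B)) ↔
      IsClosed (Set.range A) ∧ IsClosed (Set.range B) := by
    rw [ContinuousLinearMap.coe_prodMap', Set.range_prodMap]
    constructor
    · intro h
      constructor
      · convert h.preimage (Continuous.prodMk_left (0 : Y)) using 1
        ext x
        simpa using fun _ _ => ⟨0, map_zero B⟩
      · convert h.preimage (Continuous.prodMk_right (0 : X)) using 1
        ext x
        simpa using fun _ _ => ⟨0, map_zero A⟩
    · exact fun h => h.1.prod h.2
  rw [IsUpperSemiFredholm, hker, hrange]
  exact and_and_and_comm

theorem isUpperSemiBrowder_prodMap_iff {A : X →L[ℂ] X} {B : Y →L[ℂ] Y} :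
    IsUpperSemiBrowder (A.prodMap B) ↔ IsUpperSemiBrowder A ∧ IsUpperSemiBrowder B := by
  rw [IsUpperSemiBrowder, isUpperSemiFredholm_prodMap_iff, hasFiniteAscent_prodMap_iff]
  exact and_and_and_comm

theorem IsBoundedBelow.of_prodMap {A : X →L[ℂ] X} {B : Y →L[ℂ] Y}
    (h : IsBoundedBelow (A.prodMap B)) : IsBoundedBelow A ∧ IsBoundedBelow B := by
  obtain ⟨c, hc, h⟩ := h
  exact ⟨⟨c, hc, fun x => by simpa using h (x, 0)⟩, ⟨c, hc, fun y => by simpa using h (0, y)⟩⟩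

theorem upperSemiWeylSpectrum_prodMap_eq_union_iff {S : X →L[ℂ] X} {T : Y →L[ℂ] Y} :
    upperSemiWeylSpectrum (S.prodMap T) = upperSemiWeylSpectrum S ∪ upperSemiWeylSpectrum T ↔
      ∀ l, IsUpperSemiWeyl ((shift S l).prodMap (shift T l)) ↔
        IsUpperSemiWeyl (shift S l) ∧ IsUpperSemiWeyl (shift T l) := by
  simp only [upperSemiWeylSpectrum, Set.ext_iff, Set.mem_union, Set.mem_ofPred_eq, shift_prodMap,
    ← not_and_or, not_iff_not]

end BanachOp

/-- The direct sum `S ⊕ T` is `S.prodMap T`, acting on `X × Y`. -/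
theorem theorem3p5 {X Y : Type*}
    [NormedAddCommGroup X] [NormedSpace ℂ X] [CompleteSpace X]
    [NormedAddCommGroup Y] [NormedSpace ℂ Y] [CompleteSpace Y]
    (hX : ¬ FiniteDimensional ℂ X) (hY : ¬ FiniteDimensional ℂ Y)
    (S : X →L[ℂ] X) (T : Y →L[ℂ] Y)
    (hS : BanachOp.PropertyAZ S) (hT : BanachOp.PropertyAZ T) :
    BanachOp.PropertyAZ (S.prodMap T) ↔
      BanachOp.upperSemiWeylSpectrum (S.prodMap T) =
        BanachOp.upperSemiWeylSpectrum S ∪ BanachOp.upperSemiWeylSpectrum T := by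
  open BanachOp in
  rw [propertyAZ_iff] at hS hT
  rw [propertyAZ_iff, upperSemiWeylSpectrum_prodMap_eq_union_iff]
  simp only [shift_prodMap]
  refine forall_congr' fun l => ⟨fun h => ⟨fun hW => ?_, fun ⟨hWS, hWT⟩ => ?_⟩, fun h hW => ?_⟩
  · obtain ⟨hBS, hBT⟩ := isUpperSemiBrowder_prodMap_iff.1 (h hW).1
    exact ⟨hBS.isUpperSemiWeyl, hBT.isUpperSemiWeyl⟩
  · exact (isUpperSemiBrowder_prodMap_iff.2 ⟨(hS l hWS).1, (hT l hWT).1⟩).isUpperSemiWeyl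
  · obtain ⟨hWS, hWT⟩ := h.1 hW
    refine ⟨isUpperSemiBrowder_prodMap_iff.2 ⟨(hS l hWS).1, (hT l hWT).1⟩, fun hbij hbb => hbij ?_⟩
    -- A sum bounded below has summands bounded below, which (az) makes bijective.
    have hSbij := not_imp_not.1 (hS l hWS).2 hbb.of_prodMap.1
    have hTbij := not_imp_not.1 (hT l hWT).2 hbb.of_prodMap.2
    exact hSbij.prodMap hTbij
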